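/- **Theorem.** Let $P$ be a finite geometric lattice (a finite lattice that is atomic, i.e. every element is a join of atoms, and semimodular, i.e. any two distinct elements covering a common element are both covered by their join) of rank $n$. Fix an arbitrary total order on the atoms of $P$, and let $S=\{s_1<s_2<\cdots<s_k\}\subseteq\{1,\dots,n-1\}$. Let $P^S$ be the subposet of elements of $P$ whose rank lies in $S$, and let $\beta_S(P)=\tilde H_{k-1}(\Delta(P^S);\mathbb C)$ be the top reduced homology of its order complex. Let $\mathrm{Rib}(S)=\mathrm{Rib}(s_1,s_2-s_1,\dots,n-s_k)$ be the ribbon (connected skew shape without a $2\times2$ square) with these row lengths from bottom to top, whose $n$ boxes are numbered from left to right and bottom to top. We consider fillings $F$ of $\mathrm{Rib}(S)$ by the elements of a basis of the matroid of $P$ (a set of $n$ atoms with join $\hat 1$); the reading word of $F$ is the sequence $(F_1,\dots,F_n)$ of its entries in this numbering of the boxes. The tabloid $\{F\}$ is the class of $F$ modulo permutations of the entries within each row, and the ribbon polytabloid of $F$ is $$v_F=\sum_{\sigma\in \mathrm{Col}_F}\mathrm{sgn}(\sigma)\,\{\sigma F\},$$ where $\mathrm{Col}_F$ is the group of permutations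 of the entries of $F$ preserving every column. Let $\bar f_{chain}$ be the linear map from the complex vector space with basis the tabloids of shape $\mathrm{Rib}(S)$ to the complex vector space with basis the maximal chains of $P^S$ given by $$\bar f_{chain}(\{F\})=\bigl(F_1\vee\cdots\vee F_{s_1}<F_1\vee\cdots\vee F_{s_2}<\cdots<F_1\vee\cdots\vee F_{s_k}\bigr).$$ The filling $F$ is standard if its entries increase strictly from left to right in each row and from top to bottom in each column. A set $A$ of atoms is an NBC independent set if $\bigvee A$ has rank $|A|$ and every atom $a\notin A$ with $a\le\bigvee A$ comes later in the atom order than some element of $A$. The word $(F_1,\dots,F_n)$ is an NBC$^+$ basis if $F_1,\dots,F_n$ are distinct and form an NBC independent set and, for each $j=1,\dots,n$, $F_j$ is the smallest atom $a$ satisfying $a\le F_1\vee\cdots\vee F_j$ and $a\not\le F_1\vee\cdots\vee F_{j-1}$. Then, for every standard filling $T$ of $\mathrm{Rib}(S)$ whose reading word is an NBC$^+$ basis, $\bar f_{chain}(v_T)$ is a cycle, and the homology classes of the $\bar f_{chain}(v_T)$, indexed by all such $T$, form a basis of the vector space $\beta_S(P)$. -/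

import Mathlib

namespace RibbonHomology

open Finset

/-! ### Reduced homology of the order complex of a poset -/

section Homology

variable (Q : Type*) [PartialOrder Q]

/-- The faces with `k` vertices of the order complex of `Q`, that is, the chains
`u₀ < u₁ < ⋯ < u_{k-1}` (faces of dimension `k - 1`; for `k = 0` the empty face). -/
def StrictChain (k : ℕ) : Type _ := {c : Fin k → Q // StrictMono c}

variable {Q} in
/-- Delete the `i`-th element of a chain. -/
def StrictChain.erase {k : ℕ} (c : StrictChain Q (k + 1)) (i : Fin (k + 1)) : StrictChain Q k :=
  ⟨c.1 ∘ i.succAbove, c.2.comp (Fin.strictMono_succAbove i)⟩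

/-- The space of simplicial chains: the complex vector space with basis the faces with `k` vertices
of the order complex of `Q`. -/
def Chains (k : ℕ) : Type _ := StrictChain Q k →₀ ℂ

noncomputable instance (k : ℕ) : AddCommGroup (Chains Q k) :=
  inferInstanceAs (AddCommGroup (StrictChain Q k →₀ ℂ))

noncomputable instance (k : ℕ) : Module ℂ (Chains Q k) :=
  inferInstanceAs (Module ℂ (StrictChain Q k →₀ ℂ))

variable {Q} in
/-- The basis vector of the space of simplicial chains given by a face. -/
noncomputable def StrictChain.toChains {k : ℕ} (c : StrictChain Q k) : Chains Q k :=
  (Finsupp.single c 1 : StrictChain Q k →₀ ℂ)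

/-- The simplicial boundary map of the augmented chain complex of the order complex of `Q`:
`u₀ < ⋯ < u_k` is sent to `∑ i, (-1)^i (u₀ < ⋯ < û_i < ⋯ < u_k)`. -/
noncomputable def boundary (k : ℕ) : Chains Q (k + 1) →ₗ[ℂ] Chains Q k :=
  Finsupp.linearCombination ℂ fun c : StrictChain Q (k + 1) =>
    ∑ i : Fin (k + 1), ((-1 : ℂ) ^ (i : ℕ)) • (c.erase i).toChains

/-- Cycles among the chains with `k` elements (the augmented complex ends with the span of the
empty face, so everything is a cycle for `k = 0`). -/
noncomputable def cycles : (k : ℕ) → Submodule ℂ (Chains Q k)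
  | 0 => ⊤
  | k + 1 => LinearMap.ker (boundary Q k)

/-- Boundaries among the chains with `k` elements. -/
noncomputable def boundaries (k : ℕ) : Submodule ℂ (Chains Q k) :=
  LinearMap.range (boundary Q k)

/-- The reduced homology, with complex coefficients, of the order complex of `Q` in degree
`k - 1`: cycles modulo boundaries. -/
abbrev ReducedHomology (k : ℕ) : Type _ :=
  ↥(cycles Q k) ⧸ (boundaries Q k).submoduleOf (cycles Q k)

end Homology

/-! ### Rank, rank selection, atoms -/

section Rank

variable {P : Type*} [PartialOrder P]

/-- The rank of an element: the length of a longest chain descending from it. -/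
noncomputable def rank (x : P) : ℕ := (Order.height x).toNat

variable (P) in
/-- The rank-selected subposet `P^S`. -/
abbrev RankSelected (S : Finset ℕ) : Type _ := {x : P // rank x ∈ S}

variable (P) in
/-- The top homology `β_S(P)`, over the complex numbers, of the rank-selected subposet `P^S`: the order complex of `P^S`
has dimension `|S| - 1`, so this is its reduced homology in degree `|S| - 1`. -/
abbrev Beta (S : Finset ℕ) : Type _ := ReducedHomology (RankSelected P S) S.card

variable (P) in
/-- The atoms of `P`, as a type which does not inherit the order of `P`. -/
@[ext]
structure Atom [OrderBot P] where
  /-- the underlying element of `P` -/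
  val : P
  isAtom : IsAtom val

end Rank

/-! ### The rank function of a finite semimodular lattice -/

section Semimodular

variable {P : Type*}

/-- There is a saturated chain of length `k` from `u` to `y`. -/
def CovChain [PartialOrder P] : ℕ → P → P → Prop
  | 0, u, y => u = y
  | k + 1, u, y => ∃ v, u ⋖ v ∧ CovChain k v y

/-- There is a strict chain of length `k` that starts at `u` and ends below `y`. -/
def LtChain [PartialOrder P] : ℕ → P → P → Prop
  | 0, u, y => u ≤ y
  | k + 1, u, y => ∃ v, u < v ∧ LtChain k v y

theorem LtChain.le [PartialOrder P] : ∀ {k : ℕ} {u y : P}, LtChain k u y → u ≤ y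
  | 0, _, _, h => h
  | _ + 1, _, _, ⟨_, h1, h2⟩ => h1.le.trans h2.le

theorem LtChain.of_le [PartialOrder P] :
    ∀ {k : ℕ} {u u' y : P}, u' ≤ u → LtChain k u y → LtChain k u' y
  | 0, _, _, _, h, h2 => h.trans h2
  | _ + 1, _, _, _, h, ⟨v, h1, h2⟩ => ⟨v, h.trans_lt h1, h2⟩

theorem CovChain.ltChain [PartialOrder P] :
    ∀ {k : ℕ} {u y : P}, CovChain k u y → LtChain k u y
  | 0, _, _, h => le_of_eq h
  | _ + 1, _, _, ⟨v, h1, h2⟩ => ⟨v, h1.lt, h2.ltChain⟩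

theorem CovChain.snoc [PartialOrder P] :
    ∀ {k : ℕ} {u x y : P}, CovChain k u x → x ⋖ y → CovChain (k + 1) u y
  | 0, u, x, y, h, hxy => ⟨y, by cases h; exact hxy, rfl⟩
  | _ + 1, _, _, _, ⟨v, h1, h2⟩, hxy => ⟨v, h1, h2.snoc hxy⟩

theorem CovChain.exists_of_le [PartialOrder P] [Finite P] {u y : P} (h : u ≤ y) :
    ∃ k, CovChain k u y := by
  induction u using WellFoundedGT.induction with
  | ind u ih =>
    rcases h.eq_or_lt with rfl | hlt
    · exact ⟨0, rfl⟩
    · obtain ⟨v, huv, hvy⟩ := exists_covBy_le_of_lt hlt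
      obtain ⟨k, hk⟩ := ih v huv.lt hvy
      exact ⟨k + 1, v, huv, hk⟩

/-- In a finite semimodular lattice no chain between two elements is longer than a saturated
one. -/
theorem LtChain.le_of_covChain [Lattice P] [Finite P] [IsWeakUpperModularLattice P] :
    ∀ (k : ℕ) {m : ℕ} {u y : P}, CovChain k u y → LtChain m u y → m ≤ k := by
  intro k
  induction k using Nat.strong_induction_on with
  | _ k ih =>
    intro m u y hk hm
    match m, hm with
    | 0, _ => exact Nat.zero_le _
    | m + 1, ⟨z, huz, hz⟩ =>
      match k, hk with
      | 0, hk =>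
        cases hk
        exact absurd (huz.trans_le hz.le) (lt_irrefl _)
      | k + 1, ⟨x, hux, hx⟩ =>
        obtain ⟨z', huz', hz'z⟩ := exists_covBy_le_of_lt huz
        have hz' := hz.of_le hz'z
        by_cases hxz : z' = x
        · subst hxz
          exact Nat.succ_le_succ (ih k (Nat.lt_succ_self k) hx hz')
        · have hinf : x ⊓ z' = u := by
            rcases hux.eq_or_eq (le_inf hux.le huz'.le) inf_le_left with h | h
            · exact h
            · have hxz' : x ≤ z' := inf_eq_left.mp h
              rcases huz'.eq_or_eq hux.le hxz' with h' | h'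
              · exact absurd h' hux.ne'
              · exact absurd h'.symm hxz
          have hxw : x ⋖ x ⊔ z' :=
            covBy_sup_of_inf_covBy_of_inf_covBy_left (hinf ▸ hux) (hinf ▸ huz')
          have hzw : z' ⋖ x ⊔ z' :=
            covBy_sup_of_inf_covBy_of_inf_covBy_right (hinf ▸ hux) (hinf ▸ huz')
          obtain ⟨j, hj⟩ := CovChain.exists_of_le (sup_le hx.ltChain.le hz'.le)
          have h1 : j + 1 ≤ k :=
            ih k (Nat.lt_succ_self k) hx (CovChain.ltChain (k := j + 1) ⟨_, hxw, hj⟩)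
          have h2 : m ≤ j + 1 :=
            ih (j + 1) (Nat.lt_succ_of_le h1) (show CovChain (j + 1) z' y from ⟨_, hzw, hj⟩) hz'
          omega

theorem LtChain.of_series [PartialOrder P] [OrderBot P] {y : P} :
    ∀ (n : ℕ) (p : LTSeries P), p.length = n → p.last ≤ y → LtChain n p.head y := by
  intro n
  induction n with
  | zero =>
    intro p hp hy
    exact (LTSeries.head_le_last p).trans hy
  | succ n ih =>
    intro p hp hy
    have hne : p.length ≠ 0 := by omega
    refine ⟨(p.tail hne).head, ?_, ih (p.tail hne) (by simp [hp]) (by simpa using hy)⟩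
    rw [RelSeries.head_tail]
    exact p.strictMono (by
      rw [Fin.lt_def]
      simp only [Fin.val_zero]
      rw [Fin.val_one']
      rw [Nat.mod_eq_of_lt (by omega)]
      exact Nat.one_pos)

theorem LtChain.le_height [PartialOrder P] :
    ∀ {k : ℕ} {u y : P}, LtChain k u y → Order.height u + k ≤ Order.height y
  | 0, _, _, h => by simpa using Order.height_mono h
  | k + 1, u, y, ⟨v, h1, h2⟩ => by
    refine le_trans ?_ h2.le_height
    rw [Nat.cast_add, Nat.cast_one, add_comm (k : ℕ∞) 1, ← add_assoc]
    gcongr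
    exact Order.height_add_one_le h1

theorem height_ne_top [PartialOrder P] [Finite P] (x : P) : Order.height x ≠ ⊤ := by
  rw [Ne, Order.height_eq_top_iff]
  intro h
  cases nonempty_fintype P
  obtain ⟨p, _, hp⟩ := h (Fintype.card P)
  have := p.length_lt_card
  omega

theorem rank_bot [PartialOrder P] [OrderBot P] : rank (⊥ : P) = 0 := by
  simp [rank]

theorem rank_le_of_covBy [Lattice P] [OrderBot P] [Finite P] [IsWeakUpperModularLattice P]
    {x y : P} (h : x ⋖ y) : rank y ≤ rank x + 1 := by
  obtain ⟨k, hk⟩ := CovChain.exists_of_le (bot_le : ⊥ ≤ x)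
  have hx : (k : ℕ∞) ≤ Order.height x := by simpa using hk.ltChain.le_height
  have hx' : k ≤ rank x := by
    rw [rank, ← ENat.natCast_le_natCast, ENat.natCast_toNat (height_ne_top x)]
    exact hx
  obtain ⟨p, hp, hl⟩ := Order.exists_series_of_height_eq_coe y
    (ENat.natCast_toNat (height_ne_top y)).symm
  have h1 := (LtChain.of_series _ p hl hp.le).of_le bot_le
  have := LtChain.le_of_covChain (k + 1) (hk.snoc h) h1
  exact this.trans (Nat.succ_le_succ hx')

theorem covBy_sup_atom [Lattice P] [OrderBot P] [Finite P] [IsWeakUpperModularLattice P]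
    {a : P} (ha : IsAtom a) (x : P) (hax : ¬ a ≤ x) : x ⋖ x ⊔ a := by
  induction x using WellFoundedLT.induction with
  | ind x ih =>
    rcases eq_bot_or_bot_lt x with rfl | hx
    · simpa using ha.bot_covBy
    · obtain ⟨u, -, hux⟩ := exists_le_covBy_of_lt hx
      have hau : ¬ a ≤ u := fun h => hax (h.trans hux.le)
      have hu := ih u hux.lt hau
      have hinf : x ⊓ (u ⊔ a) = u := by
        rcases hux.eq_or_eq (le_inf hux.le le_sup_left) inf_le_left with h | h
        · exact h
        · have hle : x ≤ u ⊔ a := inf_eq_left.mp h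
          rcases hu.eq_or_eq hux.le hle with h' | h'
          · exact absurd h' hux.ne'
          · exact absurd (h' ▸ le_sup_right) hax
      have := covBy_sup_of_inf_covBy_of_inf_covBy_left
        (a := x) (b := u ⊔ a) (hinf.symm ▸ hux) (hinf.symm ▸ hu)
      rwa [← sup_assoc, sup_eq_left.mpr hux.le] at this

theorem rank_sup_atom_le [Lattice P] [OrderBot P] [Finite P] [IsWeakUpperModularLattice P]
    (x : P) (a : Atom P) : rank (x ⊔ a.val) ≤ rank x + 1 := by
  by_cases hax : a.val ≤ x
  · rw [sup_eq_left.mpr hax]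
    exact Nat.le_succ _
  · exact rank_le_of_covBy (covBy_sup_atom a.isAtom x hax)

end Semimodular

/-! ### Ribbon shapes, fillings, tabloids -/

section Ribbon

/-- The boxes of the ribbon `Rib(S) = Rib(s₁, s₂ - s₁, …, n - s_k)`, whose row lengths are listed
from bottom to top, are numbered `0, …, n - 1` from left to right and bottom to top. This is the
row of box `i`, rows being counted from the bottom: a new row starts after the first `s` boxes for
each `s ∈ S`. -/
def ribRow (S : Finset ℕ) {n : ℕ} (i : Fin n) : ℕ := (S.filter fun s => s ≤ (i : ℕ)).card

/-- The column of box `i`, counted from the left: each box is immediately to the right of the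
preceding one, except for the first box of a new row, which is directly above the preceding
box. -/
def ribCol (S : Finset ℕ) {n : ℕ} (i : Fin n) : ℤ := (i : ℤ) - ribRow S i

/-- The permutations of the boxes of `Rib(S)` that preserve every column. -/
def colStabilizer (S : Finset ℕ) (n : ℕ) : Finset (Equiv.Perm (Fin n)) :=
  univ.filter fun σ => ∀ i, ribCol S (σ i) = ribCol S i

/-- The permutations of the boxes of `Rib(S)` that preserve every row. -/
def rowStabilizer (S : Finset ℕ) (n : ℕ) : Subgroup (Equiv.Perm (Fin n)) where
  carrier := {σ | ∀ i, ribRow S (σ i) = ribRow S i}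
  one_mem' := fun _ => rfl
  mul_mem' := fun {σ τ} hσ hτ i => (hσ (τ i)).trans (hτ i)
  inv_mem' := fun {σ} hσ i => by simpa using (hσ (σ⁻¹ i)).symm

variable (P : Type*) [Lattice P] [BoundedOrder P]

/-- The fillings of a ribbon with `n` boxes, `n` the rank of `P`, by the elements of a basis of
the matroid of `P`: `n` distinct atoms with join `⊤`. A filling is given by its reading word. -/
def BasisFilling : Type _ :=
  {F : Fin (rank (⊤ : P)) → Atom P //
    Function.Injective F ∧ (univ.sup fun i => (F i).val) = ⊤}

variable {P}

/-- Permute the boxes of a filling. -/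
noncomputable def BasisFilling.perm (F : BasisFilling P) (σ : Equiv.Perm (Fin (rank (⊤ : P)))) :
    BasisFilling P :=
  ⟨fun i => F.1 (σ i), F.2.1.comp σ.injective, by
    refine Eq.trans (le_antisymm ?_ ?_) F.2.2
    · exact Finset.sup_le fun i _ =>
        Finset.le_sup (f := fun i => (F.1 i).val) (mem_univ (σ i))
    · refine Finset.sup_le fun i _ => ?_
      have := Finset.le_sup (f := fun i => (F.1 (σ i)).val) (mem_univ (σ.symm i))
      simpa using this⟩

variable (P) in
/-- Two fillings of `Rib(S)` are row equivalent if they differ by a permutation of the entries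
within each row. -/
def rowEquiv (S : Finset ℕ) : Setoid (BasisFilling P) where
  r F G := ∃ σ ∈ rowStabilizer S (rank (⊤ : P)), G = F.perm σ
  iseqv :=
    { refl := fun F => ⟨1, one_mem _, rfl⟩
      symm := by
        rintro F G ⟨σ, hσ, rfl⟩
        exact ⟨σ⁻¹, inv_mem hσ, Subtype.ext (funext fun i => by simp [BasisFilling.perm])⟩
      trans := by
        rintro F G H ⟨σ, hσ, rfl⟩ ⟨τ, hτ, rfl⟩
        exact ⟨σ * τ, mul_mem hσ hτ, rfl⟩ }

variable (P) in
/-- Ribbon tabloids of shape `Rib(S)`: fillings up to the order of the entries in each row. -/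
def Tabloid (S : Finset ℕ) : Type _ := Quotient (rowEquiv P S)

/-- The tabloid `{F}` of a filling `F`. -/
noncomputable def tabloid (S : Finset ℕ) (F : BasisFilling P) : Tabloid P S := Quotient.mk (rowEquiv P S) F

/-- The ribbon polytabloid `v_F = ∑_{σ ∈ Col} sgn(σ) {σF}`. -/
noncomputable def polytabloid (S : Finset ℕ) (F : BasisFilling P) : Tabloid P S →₀ ℂ :=
  ∑ σ ∈ colStabilizer S (rank (⊤ : P)),
    Finsupp.single (tabloid S (F.perm σ)) ((Equiv.Perm.sign σ : ℤ) : ℂ)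

/-! ### The map from tabloids to maximal chains of `P^S` -/

/-- The join `F₁ ∨ ⋯ ∨ F_j` of the first `j` letters of the reading word of `F`. -/
noncomputable def BasisFilling.partialJoin (F : BasisFilling P) (j : ℕ) : P :=
  (univ.filter fun i : Fin (rank (⊤ : P)) => (i : ℕ) < j).sup fun i => (F.1 i).val

theorem BasisFilling.partialJoin_mono (F : BasisFilling P) : Monotone F.partialJoin := by
  intro j k h
  refine Finset.sup_mono fun i => ?_
  simp only [mem_filter, mem_univ, true_and]
  exact fun hi => hi.trans_le h

theorem BasisFilling.partialJoin_zero (F : BasisFilling P) : F.partialJoin 0 = ⊥ := by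
  simp [BasisFilling.partialJoin]

theorem BasisFilling.partialJoin_rank (F : BasisFilling P) :
    F.partialJoin (rank (⊤ : P)) = ⊤ := by
  refine Eq.trans ?_ F.2.2
  rw [BasisFilling.partialJoin, Finset.filter_true_of_mem fun i _ => i.isLt]

theorem BasisFilling.partialJoin_succ (F : BasisFilling P) (j : Fin (rank (⊤ : P))) :
    F.partialJoin (j + 1) = F.partialJoin j ⊔ (F.1 j).val := by
  have : (univ.filter fun i : Fin (rank (⊤ : P)) => (i : ℕ) < j + 1)
      = insert j (univ.filter fun i : Fin (rank (⊤ : P)) => (i : ℕ) < j) := by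
    ext i
    simp only [mem_filter, mem_univ, true_and, mem_insert, Fin.ext_iff]
    omega
  rw [BasisFilling.partialJoin, this, Finset.sup_insert, sup_comm, BasisFilling.partialJoin]

theorem BasisFilling.partialJoin_perm (S : Finset ℕ) (F : BasisFilling P)
    {σ : Equiv.Perm (Fin (rank (⊤ : P)))} (hσ : σ ∈ rowStabilizer S (rank (⊤ : P)))
    {s : ℕ} (hs : s ∈ S) : (F.perm σ).partialJoin s = F.partialJoin s := by
  have key : ∀ τ ∈ rowStabilizer S (rank (⊤ : P)), ∀ i : Fin (rank (⊤ : P)),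
      (i : ℕ) < s → (τ i : ℕ) < s := by
    intro τ hτ i hi
    by_contra hlt
    have hlt' : s ≤ (τ i : ℕ) := not_lt.mp hlt
    have : ribRow S i < ribRow S (τ i) := by
      refine Finset.card_lt_card ⟨fun t ht => ?_, fun hsub => ?_⟩
      · simp only [mem_filter] at ht ⊢
        exact ⟨ht.1, by omega⟩
      · have := hsub (mem_filter.mpr ⟨hs, hlt'⟩)
        have := (mem_filter.mp this).2
        omega
    exact this.ne (hτ i).symm
  apply le_antisymm
  · refine Finset.sup_le fun i hi => ?_
    refine Finset.le_sup (f := fun i => (F.1 i).val) (b := σ i) ?_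
    simp only [mem_filter, mem_univ, true_and] at hi ⊢
    exact key σ hσ i hi
  · refine Finset.sup_le fun i hi => ?_
    have h1 : (F.1 i).val = ((F.perm σ).1 (σ⁻¹ i)).val := by simp [BasisFilling.perm]
    rw [h1]
    refine Finset.le_sup (f := fun i => ((F.perm σ).1 i).val) (b := σ⁻¹ i) ?_
    simp only [mem_filter, mem_univ, true_and] at hi ⊢
    exact key σ⁻¹ (inv_mem hσ) i hi

variable [Finite P] [IsWeakUpperModularLattice P]

/-- The join of the first `j` elements of an ordered basis has rank `j`. -/
theorem BasisFilling.rank_partialJoin (F : BasisFilling P) {j : ℕ} (hj : j ≤ rank (⊤ : P)) :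
    rank (F.partialJoin j) = j := by
  have hstep : ∀ i, i < rank (⊤ : P) →
      rank (F.partialJoin (i + 1)) ≤ rank (F.partialJoin i) + 1 := by
    intro i hi
    have := F.partialJoin_succ ⟨i, hi⟩
    simp only at this
    rw [this]
    exact rank_sup_atom_le _ _
  have hup : ∀ i, i ≤ rank (⊤ : P) → rank (F.partialJoin i) ≤ i := by
    intro i
    induction i with
    | zero =>
      intro _
      rw [F.partialJoin_zero, rank_bot]
    | succ i ih =>
      intro hi
      have h1 := hstep i hi
      have h2 := ih (by omega)
      omega
  have hdown : ∀ d, j + d ≤ rank (⊤ : P) →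
      rank (F.partialJoin (j + d)) ≤ rank (F.partialJoin j) + d := by
    intro d
    induction d with
    | zero => intro _; simp
    | succ d ih =>
      intro hd
      have h1 := hstep (j + d) (by omega)
      have h2 := ih (by omega)
      rw [← add_assoc]
      omega
  have h1 := hup j hj
  have h2 := hdown (rank (⊤ : P) - j) (by omega)
  rw [Nat.add_sub_cancel' hj, F.partialJoin_rank] at h2
  omega

/-- The maximal chain `F₁ ∨ ⋯ ∨ F_{s₁} < F₁ ∨ ⋯ ∨ F_{s₂} < ⋯ < F₁ ∨ ⋯ ∨ F_{s_k}` of `P^S`, where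
`S = {s₁ < ⋯ < s_k}`. -/
noncomputable def BasisFilling.selectedChain {S : Finset ℕ}
    (hS : S ⊆ Finset.Ioo 0 (rank (⊤ : P))) (F : BasisFilling P) :
    StrictChain (RankSelected P S) S.card :=
  have hle : ∀ i, S.orderEmbOfFin rfl i ≤ rank (⊤ : P) := fun i =>
    (Finset.mem_Ioo.mp (hS (S.orderEmbOfFin_mem rfl i))).2.le
  ⟨fun i => ⟨F.partialJoin (S.orderEmbOfFin rfl i), by
      rw [F.rank_partialJoin (hle i)]
      exact S.orderEmbOfFin_mem rfl i⟩, by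
    intro i j hij
    have hlt : S.orderEmbOfFin rfl i < S.orderEmbOfFin rfl j :=
      (S.orderEmbOfFin rfl).strictMono hij
    refine lt_of_le_of_ne (F.partialJoin_mono hlt.le) fun h => ?_
    have h' := congrArg rank (congrArg Subtype.val h)
    simp only at h'
    rw [F.rank_partialJoin (hle i), F.rank_partialJoin (hle j)] at h'
    exact hlt.ne h'⟩

/-- The map `f̄_chain` on tabloids of shape `Rib(S)`. -/
noncomputable def chainOfTabloid {S : Finset ℕ} (hS : S ⊆ Finset.Ioo 0 (rank (⊤ : P))) :
    Tabloid P S → StrictChain (RankSelected P S) S.card :=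
  Quotient.lift (s := rowEquiv P S) (BasisFilling.selectedChain hS) <| by
    rintro F G ⟨σ, hσ, rfl⟩
    refine Subtype.ext (funext fun i => Subtype.ext ?_)
    exact (F.partialJoin_perm S hσ (S.orderEmbOfFin_mem rfl i)).symm

/-- The linear map `f̄_chain` from the space of tabloids of shape `Rib(S)` to the space spanned by
the maximal chains of `P^S`. -/
noncomputable def fbarChain {S : Finset ℕ} (hS : S ⊆ Finset.Ioo 0 (rank (⊤ : P))) :
    (Tabloid P S →₀ ℂ) →ₗ[ℂ] Chains (RankSelected P S) S.card :=
  Finsupp.linearCombination ℂ fun t => (chainOfTabloid hS t).toChains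

end Ribbon

/-! ### Standard fillings and NBC⁺ bases with respect to an atom ordering -/

section NBC

variable {P : Type*} [Lattice P] [BoundedOrder P] [LinearOrder (Atom P)]

/-- A set of atoms is an NBC independent set if its join has rank its cardinality, and every
atom outside the set and below its join comes after some element of the set. -/
def IsNBCIndependent (A : Finset (Atom P)) : Prop :=
  rank (A.sup Atom.val) = A.card ∧
    ∀ a : Atom P, a ∉ A → a.val ≤ A.sup Atom.val → ∃ b ∈ A, b < a

/-- The reading word `(F₁, …, F_n)` of the filling is an NBC⁺ basis: an ordered NBC independent
set with `n = rk P` elements such that each `F_k` is the smallest atom which is below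
`F₁ ∨ ⋯ ∨ F_k` and not below `F₁ ∨ ⋯ ∨ F_{k-1}`. -/
def BasisFilling.IsNBCPlus (F : BasisFilling P) : Prop :=
  IsNBCIndependent (univ.image F.1) ∧
    ∀ k : Fin (rank (⊤ : P)),
      IsLeast {a : Atom P | a.val ≤ F.partialJoin (k + 1) ∧ ¬ a.val ≤ F.partialJoin k} (F.1 k)

/-- A filling of `Rib(S)` is standard if its rows increase strictly from left to right and its
columns increase strictly from top to bottom. -/
def BasisFilling.IsStandard (S : Finset ℕ) (F : BasisFilling P) : Prop :=
  (∀ i j, ribRow S i = ribRow S j → ribCol S i < ribCol S j → F.1 i < F.1 j) ∧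
    ∀ i j, ribCol S i = ribCol S j → ribRow S j < ribRow S i → F.1 i < F.1 j

variable (P) in
/-- The standard fillings of `Rib(S)` whose reading words are NBC⁺ bases. -/
def StandardNBCFilling (S : Finset ℕ) : Type _ :=
  {F : BasisFilling P // F.IsStandard S ∧ F.IsNBCPlus}

end NBC

end RibbonHomology

open RibbonHomology

/-! A chain in $P^S$ has at most $|S|$ elements, so nothing bounds in top degree and $\beta_S(P)$ is
the space of top cycles. For $s\in S$, exchanging the letters at positions $s$ and $s+1$ stays
within a column, flips the sign and changes only the join of rank $s$. Hence the boundary of the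
image of $v_F$ cancels in pairs.

The basis property rests on greedy words. A chain $c$ has a greedy word: each letter is the least
atom that lies below all elements of $c$ still to be reached and not below the current partial join.
It is lexicographically least among the words refining $c$ (`BasisFilling.IsGreedy.toLex_le`). A
standard NBC⁺ word is greedy for its own chain, and a greedy word that descends at every $s\in S$ is
standard and NBC⁺.

Independence is triangularity. A nontrivial column permutation makes a standard word
lexicographically smaller, so the chain of $T$ has coefficient 1 in the image of $v_T$ and can occur
in the image of $v_F$ only if $T\le F$.

For spanning, it suffices that a cycle vanishing on the chains of all standard NBC⁺ words is zero
(`eq_zero_of_mem_cycles`). Otherwise, take $c$ in its support with greatest greedy word. That word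
has no descent at some $s\in S$, so it is still greedy after the element of rank $s$ is deleted from
$c$. By maximality no other chain of the support contains this face, so the face survives in the
boundary. The dimension of the cycle space is thus at most the number of standard NBC⁺ words, and
independence makes it equal. -/

namespace RibbonHomology

open Finset

/-! ### Strict monotonicity of the rank, and least atoms separating two elements -/

section RankLemmas

variable {P : Type*}

theorem rank_lt_rank [PartialOrder P] [Finite P] {x y : P} (h : x < y) : rank x < rank y := by
  have h1 := Order.height_add_one_le h
  rw [← ENat.natCast_toNat (height_ne_top x), ← ENat.natCast_toNat (height_ne_top y)] at h1
  exact_mod_cast h1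

theorem rank_mono [PartialOrder P] [Finite P] {x y : P} (h : x ≤ y) : rank x ≤ rank y := by
  rcases h.eq_or_lt with rfl | h
  · exact le_rfl
  · exact (rank_lt_rank h).le

theorem eq_of_le_of_rank_le [PartialOrder P] [Finite P] {x y : P} (h : x ≤ y)
    (hr : rank y ≤ rank x) : x = y :=
  h.eq_or_lt.resolve_right fun hlt => (rank_lt_rank hlt).not_ge hr

theorem rank_sup_atom [Lattice P] [OrderBot P] [Finite P] [IsWeakUpperModularLattice P]
    {x : P} {a : Atom P} (h : ¬ a.val ≤ x) : rank (x ⊔ a.val) = rank x + 1 :=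
  le_antisymm (rank_sup_atom_le x a) (rank_lt_rank (covBy_sup_atom a.isAtom x h).lt)

instance [PartialOrder P] [OrderBot P] [Finite P] : Finite (Atom P) :=
  Finite.of_injective Atom.val fun _ _ h => Atom.ext h

theorem exists_atom_le_not_le [Lattice P] [OrderBot P] [IsAtomistic P] {x y : P}
    (h : ¬ y ≤ x) : ∃ a : Atom P, a.val ≤ y ∧ ¬ a.val ≤ x := by
  obtain ⟨s, hs, hat⟩ := IsAtomistic.isLUB_atoms y
  by_contra! hcon
  exact h (hs.2 fun a ha => hcon ⟨a, hat a ha⟩ (hs.1 ha))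

theorem exists_isLeast_atom [Lattice P] [OrderBot P] [Finite P] [IsAtomistic P]
    [LinearOrder (Atom P)] {x y : P} (h : ¬ y ≤ x) :
    ∃ a : Atom P, IsLeast {a : Atom P | a.val ≤ y ∧ ¬ a.val ≤ x} a := by
  obtain ⟨a, ha, hmin⟩ := Set.exists_min_image _ id
    (Set.toFinite {a : Atom P | a.val ≤ y ∧ ¬ a.val ≤ x}) (exists_atom_le_not_le h)
  exact ⟨a, ha, fun b hb => hmin b hb⟩

end RankLemmas

/-! ### Partial joins of a basis, and bases built by successive least choices -/

section Fillings

variable {P : Type*} [Lattice P] [BoundedOrder P]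

theorem BasisFilling.le_partialJoin (F : BasisFilling P) {i : Fin (rank (⊤ : P))} {j : ℕ}
    (h : (i : ℕ) < j) : (F.1 i).val ≤ F.partialJoin j :=
  Finset.le_sup (f := fun i => (F.1 i).val) (by simpa using h)

theorem BasisFilling.partialJoin_congr {F G : BasisFilling P} {j : ℕ}
    (h : ∀ i : Fin (rank (⊤ : P)), (i : ℕ) < j → F.1 i = G.1 i) :
    F.partialJoin j = G.partialJoin j :=
  Finset.sup_congr rfl fun i hi => by rw [h i (by simpa using hi)]

instance [Finite P] : Finite (BasisFilling P) :=
  inferInstanceAs (Finite {F : Fin (rank (⊤ : P)) → Atom P //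
    Function.Injective F ∧ (univ.sup fun i => (F i).val) = ⊤})

variable [Finite P] [IsWeakUpperModularLattice P]

theorem BasisFilling.not_le_partialJoin (F : BasisFilling P) {i : Fin (rank (⊤ : P))} {j : ℕ}
    (h : j ≤ i) : ¬ (F.1 i).val ≤ F.partialJoin j := by
  intro hle
  have h1 := F.partialJoin_succ i
  rw [sup_eq_left.mpr (hle.trans (F.partialJoin_mono h))] at h1
  have h2 := F.rank_partialJoin (j := i + 1) i.isLt
  rw [h1, F.rank_partialJoin i.isLt.le] at h2
  omega

variable [IsAtomistic P] [LinearOrder (Atom P)]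

/-- After `j` choices the join has rank `j`, less than that of `t j`, so some atom below `t j` is
still new. Applied with `t` the ceiling of a chain, this yields greedy words. -/
theorem exists_basisFilling_isLeast (t : ℕ → P)
    (hr : ∀ j < rank (⊤ : P), j < rank (t j)) :
    ∃ F : BasisFilling P, ∀ j : Fin (rank (⊤ : P)),
      IsLeast {a : Atom P | a.val ≤ t j ∧ ¬ a.val ≤ F.partialJoin j} (F.1 j) := by
  -- The step is made total by standing still when `y ≤ x`; the rank count in `hlt` excludes that
  -- case.
  have hstep : ∀ x y : P, ∃ z : P, ¬ y ≤ x →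
      ∃ a : Atom P, IsLeast {a : Atom P | a.val ≤ y ∧ ¬ a.val ≤ x} a ∧ z = x ⊔ a.val := by
    intro x y
    by_cases h : y ≤ x
    · exact ⟨x, fun h' => absurd h h'⟩
    · obtain ⟨a, ha⟩ := exists_isLeast_atom h
      exact ⟨x ⊔ a.val, fun _ => ⟨a, ha, rfl⟩⟩
  choose step hstep using hstep
  let X : ℕ → P := fun j => Nat.rec ⊥ (fun j x => step x (t j)) j
  have hX : ∀ j, X (j + 1) = step (X j) (t j) := fun _ => rfl
  have hlt : ∀ j, j < rank (⊤ : P) → rank (X j) = j → ∃ a : Atom P,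
      IsLeast {a : Atom P | a.val ≤ t j ∧ ¬ a.val ≤ X j} a ∧ X (j + 1) = X j ⊔ a.val := by
    intro j hj hrk
    refine hstep _ _ fun hle => ?_
    have h1 := rank_mono hle
    have h2 := hr j hj
    omega
  have hrank : ∀ j, j ≤ rank (⊤ : P) → rank (X j) = j := by
    intro j
    induction j with
    | zero => exact fun _ => rank_bot
    | succ j ih =>
      intro hj
      obtain ⟨a, ha, he⟩ := hlt j hj (ih (by omega))
      rw [he, rank_sup_atom ha.1.2, ih (by omega)]
  choose F hF using fun j : Fin (rank (⊤ : P)) => hlt j j.isLt (hrank j j.isLt.le)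
  have hmono : ∀ j k, j ≤ k → k ≤ rank (⊤ : P) → X j ≤ X k := by
    intro j k hjk
    induction k, hjk using Nat.le_induction with
    | base => exact fun _ => le_rfl
    | succ k _ ih =>
      intro hk
      refine (ih (by omega)).trans ?_
      rw [(hF ⟨k, hk⟩).2]
      exact le_sup_left
  have hFle : ∀ (i : Fin (rank (⊤ : P))) (j : ℕ), (i : ℕ) < j → j ≤ rank (⊤ : P) →
      (F i).val ≤ X j := by
    intro i j hij hj
    refine le_trans ?_ (hmono (i + 1) j hij hj)
    rw [(hF i).2]
    exact le_sup_right
  have hsup : ∀ j, j ≤ rank (⊤ : P) →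
      ((univ.filter fun i : Fin (rank (⊤ : P)) => (i : ℕ) < j).sup fun i => (F i).val) = X j := by
    intro j
    induction j with
    | zero => intro _; simp [X]
    | succ j ih =>
      intro hj
      refine le_antisymm (Finset.sup_le fun i hi => hFle i _ (by simpa using hi) hj) ?_
      rw [(hF ⟨j, hj⟩).2]
      refine sup_le ?_ (Finset.le_sup (f := fun i => (F i).val) (by simp))
      rw [← ih (by omega)]
      refine Finset.sup_mono fun i => ?_
      simp only [mem_filter, mem_univ, true_and]
      omega
  have hinj : ∀ i j : Fin (rank (⊤ : P)), i < j → F i ≠ F j := by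
    intro i j hij he
    exact (hF j).1.1.2 (he ▸ hFle i j hij j.isLt.le)
  refine ⟨⟨F, fun i j hij => ?_, ?_⟩, fun j => ?_⟩
  · rcases lt_trichotomy i j with h | h | h
    · exact absurd hij (hinj i j h)
    · exact h
    · exact absurd hij.symm (hinj j i h)
  · have h1 := hsup _ le_rfl
    rw [Finset.filter_true_of_mem fun i _ => i.isLt] at h1
    rw [h1]
    exact eq_of_le_of_rank_le le_top (hrank _ le_rfl).ge
  · have h1 := (hF j).1
    rw [← hsup j j.isLt.le] at h1
    exact h1

end Fillings

/-! ### Greedy fillings along a chain -/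

section Greedy

variable {P : Type*} [Lattice P] [BoundedOrder P] {S : Finset ℕ} {k : ℕ}

/-- The meet of the elements of rank greater than `j` of a chain. -/
noncomputable def ceiling (c : StrictChain (RankSelected P S) k) (j : ℕ) : P :=
  (univ.filter fun i => j < rank (c.1 i).1).inf fun i => (c.1 i).1

/-- The maximal chain of partial joins of a filling refines the given chain. -/
def BasisFilling.Refines (F : BasisFilling P) (c : StrictChain (RankSelected P S) k) : Prop :=
  ∀ i, F.partialJoin (rank (c.1 i).1) = (c.1 i).1

theorem ceiling_le (c : StrictChain (RankSelected P S) k) {j : ℕ} {i : Fin k}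
    (h : j < rank (c.1 i).1) : ceiling c j ≤ (c.1 i).1 :=
  Finset.inf_le (f := fun i => (c.1 i).1) (by simpa using h)

theorem le_ceiling {c : StrictChain (RankSelected P S) k} {j : ℕ} {x : P}
    (h : ∀ i, j < rank (c.1 i).1 → x ≤ (c.1 i).1) : x ≤ ceiling c j :=
  Finset.le_inf fun i hi => h i (by simpa using hi)

theorem ceiling_mono (c : StrictChain (RankSelected P S) k) : Monotone (ceiling c) :=
  fun _ _ h => le_ceiling fun _ hi => ceiling_le c (h.trans_lt hi)

theorem BasisFilling.Refines.le_ceiling {F : BasisFilling P}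
    {c : StrictChain (RankSelected P S) k} (hF : F.Refines c) (j : Fin (rank (⊤ : P))) :
    (F.1 j).val ≤ ceiling c j :=
  RibbonHomology.le_ceiling fun i hi => by
    rw [← hF i]
    exact F.le_partialJoin hi

/-- The ceiling is the lowest chain element of rank above `j`, or the empty meet `⊤` if there is
none. -/
theorem lt_rank_ceiling (c : StrictChain (RankSelected P S) k) {j : ℕ}
    (hj : j < rank (⊤ : P)) : j < rank (ceiling c j) := by
  rcases (univ.filter fun i => j < rank (c.1 i).1).eq_empty_or_nonempty with h | h
  · rw [ceiling, h, Finset.inf_empty]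
    exact hj
  · have hm := Finset.min'_mem _ h
    set i₀ := Finset.min' _ h
    have hi₀ : j < rank (c.1 i₀).1 := by simpa using hm
    have : ceiling c j = (c.1 i₀).1 := le_antisymm (ceiling_le c hi₀) <|
      le_ceiling fun i hi => c.2.monotone (Finset.min'_le _ _ (by simpa using hi))
    rwa [this]

theorem BasisFilling.Refines.erase {F : BasisFilling P}
    {c : StrictChain (RankSelected P S) (k + 1)} (hF : F.Refines c) (i : Fin (k + 1)) :
    F.Refines (c.erase i) :=
  fun j => hF (i.succAbove j)

theorem ceiling_le_ceiling_erase (c : StrictChain (RankSelected P S) (k + 1)) (i : Fin (k + 1))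
    (j : ℕ) : ceiling c j ≤ ceiling (c.erase i) j :=
  le_ceiling fun l hl => ceiling_le c (i := i.succAbove l) hl

theorem le_ceiling_of_erase {c : StrictChain (RankSelected P S) (k + 1)} {i : Fin (k + 1)}
    {j : ℕ} {x : P} (hx : x ≤ ceiling (c.erase i) j) (hi : j < rank (c.1 i).1 → x ≤ (c.1 i).1) :
    x ≤ ceiling c j := by
  refine le_ceiling fun l hl => ?_
  rcases eq_or_ne l i with rfl | hne
  · exact hi hl
  · obtain ⟨m, rfl⟩ := Fin.exists_succAbove_eq hne
    exact hx.trans (ceiling_le (c.erase i) (i := m) hl)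

variable [LinearOrder (Atom P)]

/-- Every letter of the filling is the least atom that keeps the partial joins below the given
chain. -/
def BasisFilling.IsGreedy (F : BasisFilling P) (c : StrictChain (RankSelected P S) k) : Prop :=
  ∀ j : Fin (rank (⊤ : P)),
    IsLeast {a : Atom P | a.val ≤ ceiling c j ∧ ¬ a.val ≤ F.partialJoin j} (F.1 j)

variable [Finite P] [IsWeakUpperModularLattice P]

theorem BasisFilling.IsGreedy.refines {F : BasisFilling P}
    {c : StrictChain (RankSelected P S) k} (hF : F.IsGreedy c) : F.Refines c := by
  intro i
  have hle : rank (c.1 i).1 ≤ rank (⊤ : P) := rank_mono le_top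
  refine eq_of_le_of_rank_le (Finset.sup_le fun j hj => ?_) (F.rank_partialJoin hle).ge
  exact (hF j).1.1.trans (ceiling_le c (by simpa using hj))

theorem exists_isGreedy [IsAtomistic P] (c : StrictChain (RankSelected P S) k) :
    ∃ F : BasisFilling P, F.IsGreedy c :=
  exists_basisFilling_isLeast (ceiling c) fun _ => lt_rank_ceiling c

/-- At the first position where the words differ, the letter of `F` is also admissible for the
greedy choice. -/
theorem BasisFilling.IsGreedy.toLex_le {F G : BasisFilling P}
    {c : StrictChain (RankSelected P S) k} (hG : G.IsGreedy c) (hF : F.Refines c) :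
    toLex G.1 ≤ toLex F.1 := by
  by_contra! hlt
  obtain ⟨j, hj, hFG⟩ := hlt
  refine hFG.not_ge ((hG j).2 ⟨hF.le_ceiling j, ?_⟩)
  rw [← BasisFilling.partialJoin_congr fun i hi => hj i hi]
  exact F.not_le_partialJoin le_rfl

/-- The later letter was already a candidate at the earlier position. -/
theorem BasisFilling.IsGreedy.le_of_ceiling_le {F : BasisFilling P}
    {c : StrictChain (RankSelected P S) k} (hF : F.IsGreedy c) {i j : Fin (rank (⊤ : P))}
    (hij : i ≤ j) (h : ceiling c j ≤ ceiling c i) : F.1 i ≤ F.1 j :=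
  (hF i).2 ⟨(hF j).1.1.trans h, F.not_le_partialJoin hij⟩

/-- A greedy filling without a descent at an element of the chain stays greedy when this element
is deleted. -/
theorem BasisFilling.IsGreedy.erase {F : BasisFilling P}
    {c : StrictChain (RankSelected P S) (k + 1)} (hF : F.IsGreedy c) {i : Fin (k + 1)}
    {p q : Fin (rank (⊤ : P))} (hq : (q : ℕ) = rank (c.1 i).1) (hp : (p : ℕ) + 1 = q)
    (hpq : F.1 p ≤ F.1 q) : F.IsGreedy (c.erase i) := by
  intro j
  refine ⟨⟨(hF j).1.1.trans (ceiling_le_ceiling_erase c i j), (hF j).1.2⟩, ?_⟩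
  rintro a ⟨ha, haj⟩
  by_cases hac : a.val ≤ ceiling c j
  · exact (hF j).2 ⟨hac, haj⟩
  -- An atom that becomes admissible only through the deletion was blocked by the deleted element
  -- alone. It is then a candidate at `q`, just after that element is reached.
  have hji : j < rank (c.1 i).1 ∧ ¬ a.val ≤ (c.1 i).1 := by
    by_contra! hcon
    exact hac (le_ceiling_of_erase ha hcon)
  have hqa : F.1 q ≤ a := by
    refine (hF q).2 ⟨le_ceiling_of_erase (i := i)
      (ha.trans (ceiling_mono _ (by omega))) fun h => absurd h (by omega), ?_⟩
    rw [hq, hF.refines i]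
    exact hji.2
  refine le_trans ?_ (hpq.trans hqa)
  -- Positions `j` and `p` lie in one block: a chain element before index `i` of rank above `j`
  -- would put `a` below the deleted element.
  refine hF.le_of_ceiling_le (by rw [Fin.le_def]; omega) ?_
  refine le_ceiling fun l hl => ?_
  rcases lt_or_ge l i with hli | hli
  · obtain ⟨m, rfl⟩ := Fin.exists_succAbove_eq hli.ne
    exact absurd (ha.trans ((ceiling_le (c.erase i) (i := m) hl).trans (c.2.monotone hli.le)))
      hji.2
  · exact (ceiling_le c (i := i) (by omega)).trans (c.2.monotone hli)

end Greedy

/-! ### Simplicial chains -/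

section SimplicialChains

variable {Q : Type*} [PartialOrder Q] {k : ℕ}

/-- The coefficient of a face in a simplicial chain. -/
noncomputable def coeff (d : StrictChain Q k) : Chains Q k →ₗ[ℂ] ℂ :=
  (Finsupp.lapply d : (StrictChain Q k →₀ ℂ) →ₗ[ℂ] ℂ)

open Classical in
theorem coeff_toChains (d c : StrictChain Q k) : coeff d c.toChains = if c = d then 1 else 0 :=
  Finsupp.single_apply

theorem boundary_toChains (c : StrictChain Q (k + 1)) :
    boundary Q k c.toChains = ∑ i : Fin (k + 1), ((-1 : ℂ) ^ (i : ℕ)) • (c.erase i).toChains :=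
  (Finsupp.linearCombination_single ℂ (1 : ℂ) c).trans (one_smul _ _)

theorem eq_sum_coeff_smul (z : Chains Q k) :
    z = ∑ c ∈ (z : StrictChain Q k →₀ ℂ).support, coeff c z • c.toChains := by
  refine ((Finsupp.sum_single (z : StrictChain Q k →₀ ℂ)).symm).trans ?_
  refine Finset.sum_congr rfl fun c _ => ?_
  refine Eq.trans ?_ (Finsupp.smul_single_one c (z.toFun c)).symm
  rfl

theorem coeff_boundary (z : Chains Q (k + 1)) (d : StrictChain Q k) :
    coeff d (boundary Q k z) = ∑ c ∈ (z : StrictChain Q (k + 1) →₀ ℂ).support,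
      coeff c z * ∑ i : Fin (k + 1), (-1 : ℂ) ^ (i : ℕ) * coeff d (c.erase i).toChains := by
  conv_lhs => rw [eq_sum_coeff_smul z]
  simp only [map_sum, map_smul, boundary_toChains, smul_eq_mul]

theorem mem_cycles_succ {z : Chains Q (k + 1)} :
    z ∈ cycles Q (k + 1) ↔ boundary Q k z = 0 :=
  LinearMap.mem_ker

/-- A signed sum of faces is a cycle if every vertex can be removed from the faces by a
sign-reversing involution of the index set. -/
theorem sum_sign_smul_mem_cycles {ι : Type*} [Fintype ι] [DecidableEq ι]
    (H : Finset (Equiv.Perm ι)) (G : Equiv.Perm ι → StrictChain Q k)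
    (hG : ∀ i : Fin k, ∃ τ : Equiv.Perm ι, Equiv.Perm.sign τ = -1 ∧ τ * τ = 1 ∧
      ∀ σ ∈ H, σ * τ ∈ H ∧ ∀ j ≠ i, (G (σ * τ)).1 j = (G σ).1 j) :
    ∑ σ ∈ H, ((Equiv.Perm.sign σ : ℤ) : ℂ) • (G σ).toChains ∈ cycles Q k := by
  cases k with
  | zero => exact Submodule.mem_top
  | succ k =>
    rw [mem_cycles_succ]
    simp only [map_sum, map_smul, boundary_toChains, Finset.smul_sum]
    rw [Finset.sum_comm]
    refine Finset.sum_eq_zero fun i _ => ?_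
    obtain ⟨τ, hsign, hτ, h⟩ := hG i
    have herase : ∀ σ ∈ H, (G (σ * τ)).erase i = (G σ).erase i := fun σ hσ =>
      Subtype.ext (funext fun j => (h σ hσ).2 _ (Fin.succAbove_ne i j))
    refine Finset.sum_involution (fun σ _ => σ * τ) (fun σ hσ => ?_) (fun σ hσ _ he => ?_)
      (fun σ hσ => (h σ hσ).1) fun σ hσ => by rw [mul_assoc, hτ, mul_one]
    · rw [herase σ hσ, Equiv.Perm.sign_mul, hsign]
      simp
    · rw [mul_eq_left] at he
      rw [he, Equiv.Perm.sign_one] at hsign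
      exact absurd hsign (by decide)

end SimplicialChains

/-! ### Maximal chains of a rank-selected subposet -/

section MaximalChains

variable {P : Type*} [PartialOrder P] [Finite P] {S : Finset ℕ} {k : ℕ}

theorem rank_chain_strictMono (c : StrictChain (RankSelected P S) k) :
    StrictMono fun i => rank (c.1 i).1 :=
  fun _ _ h => rank_lt_rank (c.2 h)

/-- The ranks are `|S|` strictly increasing members of `S`, hence its increasing enumeration. -/
theorem rank_chain_eq (hk : S.card = k) (c : StrictChain (RankSelected P S) k) (i : Fin k) :
    rank (c.1 i).1 = S.orderEmbOfFin hk i :=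
  congrFun (orderEmbOfFin_unique hk (fun i => (c.1 i).2) (rank_chain_strictMono c)) i

theorem exists_rank_chain_eq (hk : S.card = k) (c : StrictChain (RankSelected P S) k) {s : ℕ}
    (hs : s ∈ S) : ∃ i, rank (c.1 i).1 = s := by
  have : s ∈ Set.range (S.orderEmbOfFin hk) := by
    rw [range_orderEmbOfFin]
    exact hs
  obtain ⟨i, rfl⟩ := this
  exact ⟨i, rank_chain_eq hk c i⟩

/-- The one rank of `S` missing from the face reveals the deleted position. -/
theorem eq_of_erase_eq_erase (hk : S.card = k + 1) {c c' : StrictChain (RankSelected P S) (k + 1)}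
    {i i' : Fin (k + 1)} (h : c.erase i = c'.erase i') : i = i' := by
  by_contra hne
  obtain ⟨m, rfl⟩ := Fin.exists_succAbove_eq hne
  have h1 : c.1 ((i'.succAbove m).succAbove m) = c'.1 (i'.succAbove m) :=
    congrFun (congrArg Subtype.val h) m
  have h2 := congrArg (fun x => rank x.1) h1
  simp only [rank_chain_eq hk] at h2
  exact Fin.succAbove_ne _ _ ((S.orderEmbOfFin hk).injective h2)

theorem boundaries_card_eq_bot : boundaries (RankSelected P S) S.card = ⊥ := by
  have : IsEmpty (StrictChain (RankSelected P S) (S.card + 1)) := by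
    refine ⟨fun c => ?_⟩
    have h := Finset.card_le_card_of_injOn (s := univ) (t := S) (fun i => rank (c.1 i).1)
      (fun i _ => (c.1 i).2) (rank_chain_strictMono c).injective.injOn
    simp at h
  have hsub : Subsingleton (Chains (RankSelected P S) (S.card + 1)) :=
    inferInstanceAs (Subsingleton (StrictChain (RankSelected P S) (S.card + 1) →₀ ℂ))
  refine (Submodule.eq_bot_iff _).mpr ?_
  rintro _ ⟨z, rfl⟩
  rw [Subsingleton.elim z 0, map_zero]

end MaximalChains

theorem refines_iff_selectedChain_eq {P : Type*} [Lattice P] [BoundedOrder P] [Finite P]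
    [IsWeakUpperModularLattice P] {S : Finset ℕ} (hS : S ⊆ Finset.Ioo 0 (rank (⊤ : P))) {F : BasisFilling P}
    {c : StrictChain (RankSelected P S) S.card} : F.Refines c ↔ F.selectedChain hS = c := by
  constructor
  · intro h
    refine Subtype.ext (funext fun i => Subtype.ext ?_)
    rw [← h i, rank_chain_eq rfl]
    rfl
  · rintro rfl i
    rw [rank_chain_eq rfl]
    rfl

/-! ### Rows and columns of ribbons -/

section RibbonShape

variable {S : Finset ℕ} {n : ℕ}

theorem ribRow_eq_add {i j : Fin n} (h : i ≤ j) :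
    ribRow S j = ribRow S i + (S.filter fun s => (i : ℕ) < s ∧ s ≤ j).card := by
  rw [ribRow, ribRow, ← Finset.card_union_of_disjoint]
  · congr 1
    ext s
    simp only [mem_filter, mem_union]
    rw [Fin.le_def] at h
    constructor
    · rintro ⟨h1, h2⟩
      rcases le_or_gt s i with h3 | h3
      · exact Or.inl ⟨h1, h3⟩
      · exact Or.inr ⟨h1, h3, h2⟩
    · rintro (⟨h1, h2⟩ | ⟨h1, -, h2⟩)
      · exact ⟨h1, h2.trans h⟩
      · exact ⟨h1, h2⟩
  · rw [Finset.disjoint_filter]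
    intro s _ h1 h2
    omega

theorem ribRow_eq_ribRow_iff {i j : Fin n} (h : i ≤ j) :
    ribRow S i = ribRow S j ↔ ∀ s ∈ S, (i : ℕ) < s → ¬ s ≤ j := by
  rw [ribRow_eq_add h, left_eq_add, Finset.card_eq_zero, Finset.filter_eq_empty_iff]
  simp only [not_and]

theorem ribRow_mono {i j : Fin n} (h : i ≤ j) : ribRow S i ≤ ribRow S j := by
  rw [ribRow_eq_add h]
  exact Nat.le_add_right _ _

/-- Equal columns mean that the row number grows as fast as the box number, so every box after `i`
up to `j` starts a new row. -/
theorem mem_of_ribCol_eq {i j : Fin n} (h : i ≤ j) (hc : ribCol S i = ribCol S j) {s : ℕ}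
    (h1 : (i : ℕ) < s) (h2 : s ≤ j) : s ∈ S := by
  have hsub : (S.filter fun s => (i : ℕ) < s ∧ s ≤ j) ⊆ Finset.Ioc (i : ℕ) j := fun t ht => by
    simpa using (mem_filter.mp ht).2
  have hrow := ribRow_eq_add (S := S) h
  have heq := Finset.eq_of_subset_of_card_le hsub <| by
    rw [Nat.card_Ioc]
    simp only [ribCol] at hc
    omega
  have hs : s ∈ Finset.Ioc (i : ℕ) j := by simp [h1, h2]
  rw [← heq] at hs
  exact (mem_filter.mp hs).1

theorem ribRow_succ_of_mem {p q : Fin n} (hpq : (p : ℕ) + 1 = q) (hq : (q : ℕ) ∈ S) :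
    ribRow S q = ribRow S p + 1 := by
  rw [ribRow_eq_add (i := p) (by rw [Fin.le_def]; omega), Nat.add_left_cancel_iff,
    Finset.card_eq_one]
  refine ⟨q, ?_⟩
  ext s
  simp only [mem_filter, mem_singleton]
  constructor
  · rintro ⟨-, h1, h2⟩
    omega
  · rintro rfl
    exact ⟨hq, by omega, le_rfl⟩

theorem ribCol_eq_of_succ_mem {p q : Fin n} (hpq : (p : ℕ) + 1 = q) (hq : (q : ℕ) ∈ S) :
    ribCol S p = ribCol S q := by
  simp only [ribCol, ribRow_succ_of_mem hpq hq]
  omega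

theorem swap_mul_mem_colStabilizer {σ : Equiv.Perm (Fin n)} (hσ : σ ∈ colStabilizer S n)
    {p q : Fin n} (hpq : (p : ℕ) + 1 = q) (hq : (q : ℕ) ∈ S) :
    σ * Equiv.swap p q ∈ colStabilizer S n := by
  simp only [colStabilizer, mem_filter, mem_univ, true_and, Equiv.Perm.mul_apply] at hσ ⊢
  intro i
  rw [hσ, Equiv.swap_apply_def]
  split_ifs with h1 h2
  · rw [h1, ribCol_eq_of_succ_mem hpq hq]
  · rw [h2, ribCol_eq_of_succ_mem hpq hq]
  · rfl

theorem one_mem_colStabilizer : 1 ∈ colStabilizer S n := by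
  simp [colStabilizer]

/-- Using the two-row shape cut at `t` alone, `partialJoin_perm` then shows that the swap preserves
the join of the first `t` letters. -/
theorem swap_mem_rowStabilizer_singleton {p q : Fin n} (hpq : (p : ℕ) + 1 = q) {t : ℕ}
    (ht : t ≠ q) : Equiv.swap p q ∈ rowStabilizer {t} n := by
  have h : ribRow {t} p = ribRow {t} q := by
    rw [ribRow_eq_ribRow_iff (by rw [Fin.le_def]; omega)]
    intro s hs
    rw [mem_singleton] at hs
    omega
  intro i
  rw [Equiv.swap_apply_def]
  split_ifs with h1 h2
  · rw [h1, h]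
  · rw [h2, h]
  · rfl

end RibbonShape

/-! ### Standard fillings -/

section Standard

variable {P : Type*} [Lattice P] [BoundedOrder P] [LinearOrder (Atom P)] {S : Finset ℕ}

theorem BasisFilling.IsStandard.lt_of_row {F : BasisFilling P} (hF : F.IsStandard S)
    {i j : Fin (rank (⊤ : P))} (hij : i < j) (h : ∀ s ∈ S, (i : ℕ) < s → ¬ s ≤ j) :
    F.1 i < F.1 j := by
  have hrow := (ribRow_eq_ribRow_iff hij.le).mpr h
  refine hF.1 i j hrow ?_
  rw [Fin.lt_def] at hij
  simp only [ribCol, hrow]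
  omega

theorem BasisFilling.IsStandard.lt_of_col {F : BasisFilling P} (hF : F.IsStandard S)
    {i j : Fin (rank (⊤ : P))} (hij : i < j) (h : ribCol S i = ribCol S j) :
    F.1 j < F.1 i := by
  refine hF.2 j i h.symm ?_
  rw [Fin.lt_def] at hij
  simp only [ribCol] at h
  omega

/-- A word is standard if it ascends along rows and descends where a new row starts. -/
theorem BasisFilling.isStandard_of_descents {F : BasisFilling P}
    (hrow : ∀ i j : Fin (rank (⊤ : P)), i < j → (∀ s ∈ S, (i : ℕ) < s → ¬ s ≤ j) → F.1 i < F.1 j)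
    (hdes : ∀ p q : Fin (rank (⊤ : P)), (p : ℕ) + 1 = q → (q : ℕ) ∈ S → F.1 q < F.1 p) :
    F.IsStandard S := by
  refine ⟨fun i j hr hc => ?_, fun j i hc hr => ?_⟩
  · have hij : i < j := by
      rw [Fin.lt_def]
      simp only [ribCol, hr] at hc
      omega
    exact hrow i j hij ((ribRow_eq_ribRow_iff hij.le).mp hr)
  · have hij : i < j := lt_of_not_ge fun h => (ribRow_mono h).not_gt hr
    -- A column is a run of consecutive boxes, so its descents compose.
    have key : ∀ (m : ℕ) (j : Fin (rank (⊤ : P))), (j : ℕ) = i + m + 1 →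
        (∀ s, (i : ℕ) < s → s ≤ j → s ∈ S) → F.1 j < F.1 i := by
      intro m
      induction m with
      | zero => exact fun j hj hs => hdes i j (by omega) (hs j (by omega) le_rfl)
      | succ m ih =>
        intro j hj hs
        have hlt : (i : ℕ) + m + 1 < rank (⊤ : P) := by omega
        exact (hdes ⟨i + m + 1, hlt⟩ j (by simp only; omega) (hs j (by omega) le_rfl)).trans
          (ih ⟨i + m + 1, hlt⟩ rfl fun s h1 h2 => hs s h1 (by simp only at h2; omega))
    rw [Fin.lt_def] at hij
    exact key (j - i - 1) j (by omega) fun s h1 h2 =>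
      mem_of_ribCol_eq (Fin.le_def.mpr hij.le) hc.symm h1 h2

/-- The first box moved receives the entry of a later box in its column. Boxes are numbered upwards
while columns increase downwards, so that entry is smaller. -/
theorem BasisFilling.IsStandard.perm_lt {F : BasisFilling P} (hF : F.IsStandard S)
    {σ : Equiv.Perm (Fin (rank (⊤ : P)))} (hσ : σ ∈ colStabilizer S (rank (⊤ : P)))
    (hne : σ ≠ 1) : toLex (F.perm σ).1 < toLex F.1 := by
  simp only [colStabilizer, mem_filter, mem_univ, true_and] at hσ
  have hex : (univ.filter fun i => σ i ≠ i).Nonempty := by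
    by_contra hcon
    rw [Finset.not_nonempty_iff_eq_empty, Finset.filter_eq_empty_iff] at hcon
    exact hne (Equiv.ext fun i => not_not.mp (hcon (mem_univ i)))
  have hj := Finset.min'_mem _ hex
  have hmin : ∀ i, i < Finset.min' _ hex → σ i = i := fun i hi => by
    by_contra h
    exact hi.not_ge (Finset.min'_le _ _ (by simpa using h))
  set j := Finset.min' _ hex
  have hj' : σ j ≠ j := by simpa using hj
  refine ⟨j, fun i hi => congrArg F.1 (hmin i hi), ?_⟩
  refine hF.lt_of_col (lt_of_le_of_ne (le_of_not_gt fun hlt => ?_) hj'.symm) (hσ j).symm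
  exact hj' (σ.injective (hmin _ hlt))

theorem BasisFilling.IsStandard.perm_le {F : BasisFilling P} (hF : F.IsStandard S)
    {σ : Equiv.Perm (Fin (rank (⊤ : P)))} (hσ : σ ∈ colStabilizer S (rank (⊤ : P))) :
    toLex (F.perm σ).1 ≤ toLex F.1 := by
  rcases eq_or_ne σ 1 with rfl | hne
  · exact le_rfl
  · exact (hF.perm_lt hσ hne).le

variable [Finite P] [IsWeakUpperModularLattice P] {k : ℕ}

/-- Let a candidate `a` at position `j` first fall below the partial joins at letter `l`; NBC⁺ gives
`F_l ≤ a`. No rank of `c` lies between `j` and `l`, since `a` would already be below that partial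
join. So `j` and `l` share a row and `F_j ≤ F_l`. -/
theorem BasisFilling.IsStandard.isGreedy {F : BasisFilling P} (hF : F.IsStandard S)
    (hF' : F.IsNBCPlus) (hk : S.card = k) {c : StrictChain (RankSelected P S) k}
    (hc : F.Refines c) : F.IsGreedy c := by
  intro j
  refine ⟨⟨hc.le_ceiling j, F.not_le_partialJoin le_rfl⟩, ?_⟩
  rintro a ⟨ha, haj⟩
  have hex : ∃ m, a.val ≤ F.partialJoin m := ⟨rank (⊤ : P), by rw [F.partialJoin_rank]; exact le_top⟩
  classical
  have hfind := Nat.find_spec hex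
  have hmin : ∀ m, m < Nat.find hex → ¬ a.val ≤ F.partialJoin m := fun m => Nat.find_min hex
  have hle : Nat.find hex ≤ rank (⊤ : P) :=
    Nat.find_min' hex (by rw [F.partialJoin_rank]; exact le_top)
  have hlt : (j : ℕ) < Nat.find hex := lt_of_not_ge fun h =>
    haj (hfind.trans (F.partialJoin_mono h))
  obtain ⟨l, hl⟩ : ∃ l, Nat.find hex = l + 1 := ⟨Nat.find hex - 1, by omega⟩
  rw [hl] at hfind hmin hle hlt
  have h1 : F.1 ⟨l, hle⟩ ≤ a := (hF'.2 ⟨l, hle⟩).2 ⟨hfind, hmin l (Nat.lt_succ_self l)⟩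
  rcases (Nat.le_of_lt_succ hlt).eq_or_lt with h | h
  · have : j = ⟨l, hle⟩ := Fin.ext h
    rwa [this]
  · refine (hF.lt_of_row (j := ⟨l, hle⟩) h fun s hs hjs hsl => ?_).le.trans h1
    obtain ⟨i, rfl⟩ := exists_rank_chain_eq hk c hs
    refine hmin _ (Nat.lt_succ_of_le hsl) ?_
    rw [hc i]
    exact ha.trans (ceiling_le c hjs)

/-- Each partial join lies below the ceiling, so a greedy letter is least among even more candidates
than NBC⁺ demands. -/
theorem BasisFilling.IsGreedy.isNBCPlus {F : BasisFilling P}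
    {c : StrictChain (RankSelected P S) k} (hF : F.IsGreedy c) : F.IsNBCPlus := by
  have hleast : ∀ j : Fin (rank (⊤ : P)),
      IsLeast {a : Atom P | a.val ≤ F.partialJoin (j + 1) ∧ ¬ a.val ≤ F.partialJoin j} (F.1 j) := by
    intro j
    refine ⟨⟨F.le_partialJoin (Nat.lt_succ_self _), F.not_le_partialJoin le_rfl⟩, ?_⟩
    rintro a ⟨ha, haj⟩
    refine (hF j).2 ⟨ha.trans ?_, haj⟩
    refine RibbonHomology.le_ceiling fun i hi => ?_
    rw [← hF.refines i]
    exact F.partialJoin_mono hi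
  refine ⟨⟨?_, fun a ha _ => ?_⟩, hleast⟩
  · have h1 : (univ.image F.1).sup Atom.val = ⊤ := by
      rw [Finset.sup_image]
      exact F.2.2
    rw [h1, Finset.card_image_of_injective _ F.2.1, Finset.card_univ, Fintype.card_fin]
  · have hstep : ∀ m, m ≤ rank (⊤ : P) → a.val ≤ F.partialJoin m →
        ∃ j : Fin (rank (⊤ : P)), F.1 j ≤ a := by
      intro m
      induction m with
      | zero =>
        intro _ h
        rw [F.partialJoin_zero, le_bot_iff] at h
        exact absurd h a.isAtom.1
      | succ m ih =>
        intro hm h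
        by_cases h' : a.val ≤ F.partialJoin m
        · exact ih (by omega) h'
        · exact ⟨⟨m, hm⟩, (hleast ⟨m, hm⟩).2 ⟨h, h'⟩⟩
    obtain ⟨j, hj⟩ := hstep _ le_rfl (by rw [F.partialJoin_rank]; exact le_top)
    have hjm : F.1 j ∈ univ.image F.1 := mem_image_of_mem _ (mem_univ j)
    exact ⟨F.1 j, hjm, lt_of_le_of_ne hj fun h => ha (h ▸ hjm)⟩

/-- Within a row the ceiling does not change, so greedy letters ascend there automatically; only the
descents need assuming. -/
theorem BasisFilling.IsGreedy.isStandard {F : BasisFilling P}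
    {c : StrictChain (RankSelected P S) k} (hF : F.IsGreedy c)
    (hdes : ∀ p q : Fin (rank (⊤ : P)), (p : ℕ) + 1 = q → (q : ℕ) ∈ S → F.1 q < F.1 p) :
    F.IsStandard S := by
  refine F.isStandard_of_descents (fun i j hij h => ?_) hdes
  refine lt_of_le_of_ne (hF.le_of_ceiling_le hij.le ?_) fun he => hij.ne (F.2.1 he)
  refine le_ceiling fun l hl => ceiling_le c ?_
  exact not_le.mp (h _ (c.1 l).2 hl)

end Standard

/-! ### The images of ribbon polytabloids -/

section Polytabloids

variable {P : Type*} [Lattice P] [BoundedOrder P] [Finite P] [IsWeakUpperModularLattice P]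
  {S : Finset ℕ} (hS : S ⊆ Finset.Ioo 0 (rank (⊤ : P)))

theorem fbarChain_polytabloid (F : BasisFilling P) :
    fbarChain hS (polytabloid S F) = ∑ σ ∈ colStabilizer S (rank (⊤ : P)),
      ((Equiv.Perm.sign σ : ℤ) : ℂ) • ((F.perm σ).selectedChain hS).toChains := by
  rw [polytabloid, map_sum]
  exact Finset.sum_congr rfl fun σ _ => Finsupp.linearCombination_single ℂ _ _

theorem fbarChain_polytabloid_mem_cycles (F : BasisFilling P) :
    fbarChain hS (polytabloid S F) ∈ cycles (RankSelected P S) S.card := by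
  rw [fbarChain_polytabloid]
  refine sum_sign_smul_mem_cycles _ (fun σ => (F.perm σ).selectedChain hS) fun i => ?_
  have hi := S.orderEmbOfFin_mem rfl i
  have hi' := Finset.mem_Ioo.mp (hS hi)
  obtain ⟨m, hm⟩ : ∃ m, S.orderEmbOfFin rfl i = m + 1 :=
    ⟨S.orderEmbOfFin rfl i - 1, by omega⟩
  have hlt : m + 1 < rank (⊤ : P) := hm ▸ hi'.2
  let p : Fin (rank (⊤ : P)) := ⟨m, by omega⟩
  let q : Fin (rank (⊤ : P)) := ⟨m + 1, hlt⟩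
  have hpq : (p : ℕ) + 1 = q := rfl
  have hq : (q : ℕ) ∈ S := by
    rw [hm] at hi
    exact hi
  refine ⟨Equiv.swap p q, Equiv.Perm.sign_swap fun h => ?_, Equiv.swap_mul_self p q,
    fun σ hσ => ⟨swap_mul_mem_colStabilizer hσ hpq hq, fun j hj => Subtype.ext ?_⟩⟩
  · have := congrArg Fin.val h
    omega
  · refine (F.perm σ).partialJoin_perm {S.orderEmbOfFin rfl j}
      (swap_mem_rowStabilizer_singleton hpq ?_) (mem_singleton_self _)
    intro h
    exact hj ((S.orderEmbOfFin rfl).injective (h.trans hm.symm))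

variable [LinearOrder (Atom P)]

/-- A standard NBC⁺ filling is lexicographically least among the fillings with the same chain. -/
theorem BasisFilling.IsStandard.toLex_le_of_selectedChain_eq {T F : BasisFilling P}
    (hT : T.IsStandard S) (hT' : T.IsNBCPlus)
    (h : F.selectedChain hS = T.selectedChain hS) : toLex T.1 ≤ toLex F.1 :=
  (hT.isGreedy hT' rfl ((refines_iff_selectedChain_eq hS).mpr rfl)).toLex_le
    ((refines_iff_selectedChain_eq hS).mpr h)

/-- Only the identity contributes: any other column permutation gives a smaller word, while `T` is
least for its chain. -/
theorem coeff_fbarChain_polytabloid_self {T : BasisFilling P} (hT : T.IsStandard S)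
    (hT' : T.IsNBCPlus) :
    coeff (T.selectedChain hS) (fbarChain hS (polytabloid S T)) = 1 := by
  rw [fbarChain_polytabloid, map_sum, Finset.sum_eq_single 1]
  · have h1 : T.perm 1 = T := rfl
    simp [coeff_toChains, h1]
  · intro σ hσ hne
    rw [map_smul, coeff_toChains, if_neg, smul_zero]
    intro h
    exact (hT.perm_lt hσ hne).not_ge (hT.toLex_le_of_selectedChain_eq hS hT' h)
  · exact fun h => absurd one_mem_colStabilizer h

theorem toLex_le_of_coeff_ne_zero {T F : BasisFilling P} (hT : T.IsStandard S)
    (hT' : T.IsNBCPlus) (hF : F.IsStandard S)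
    (h : coeff (T.selectedChain hS) (fbarChain hS (polytabloid S F)) ≠ 0) :
    toLex T.1 ≤ toLex F.1 := by
  rw [fbarChain_polytabloid, map_sum] at h
  obtain ⟨σ, hσ, hne⟩ := Finset.exists_ne_zero_of_sum_ne_zero h
  rw [map_smul, coeff_toChains] at hne
  split_ifs at hne with he
  · exact (hT.toLex_le_of_selectedChain_eq hS hT' he).trans (hF.perm_le hσ)
  · simp at hne

theorem linearIndependent_fbarChain_polytabloid :
    LinearIndependent ℂ fun T : StandardNBCFilling P S => fbarChain hS (polytabloid S T.1) := by
  rw [linearIndependent_iff']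
  intro s g hg
  by_contra! hcon
  have hne : (s.filter fun T => g T ≠ 0).Nonempty := by
    obtain ⟨T, hT⟩ := hcon
    exact ⟨T, mem_filter.mpr hT⟩
  -- At the chain of the greatest word in the relation, triangularity kills every other term.
  obtain ⟨T, hT, hmax⟩ := Finset.exists_max_image _
    (fun T : StandardNBCFilling P S => toLex T.1.1) hne
  rw [mem_filter] at hT
  have h1 := congrArg (coeff (T.1.selectedChain hS)) hg
  rw [map_sum, map_zero, Finset.sum_eq_single T] at h1
  · rw [map_smul, coeff_fbarChain_polytabloid_self hS T.2.1 T.2.2] at h1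
    simp only [smul_eq_mul, mul_one] at h1
    exact hT.2 h1
  · intro T' hT' hne'
    rw [map_smul]
    by_cases hg' : g T' = 0
    · rw [hg', zero_smul]
    · by_cases hc : coeff (T.1.selectedChain hS) (fbarChain hS (polytabloid S T'.1)) = 0
      · rw [hc, smul_zero]
      · have h2 := toLex_le_of_coeff_ne_zero hS T.2.1 T.2.2 T'.2.1 hc
        have h3 := hmax T' (mem_filter.mpr ⟨hT', hg'⟩)
        exact absurd (Subtype.ext (Subtype.ext (toLex.injective (le_antisymm h3 h2)))) hne'
  · exact fun h => absurd hT.1 h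

end Polytabloids

/-! ### Cycles are determined by the chains of standard fillings -/

section Spanning

variable {P : Type*} [Lattice P] [BoundedOrder P] [Finite P] [IsWeakUpperModularLattice P]
  [IsAtomistic P] [LinearOrder (Atom P)] {S : Finset ℕ}

theorem eq_zero_of_mem_cycles {k : ℕ} (hk : S.card = k)
    {z : Chains (RankSelected P S) k} (hz : z ∈ cycles (RankSelected P S) k)
    (h : ∀ (T : StandardNBCFilling P S) (c : StrictChain (RankSelected P S) k),
      T.1.Refines c → coeff c z = 0) : z = 0 := by
  by_contra hne
  have hsupp : (z : StrictChain (RankSelected P S) k →₀ ℂ).support.Nonempty :=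
    Finsupp.support_nonempty_iff.mpr hne
  choose G hG using fun c : StrictChain (RankSelected P S) k => exists_isGreedy c
  obtain ⟨c, hc, hmax⟩ := Finset.exists_max_image _ (fun c => toLex (G c).1) hsupp
  have hc0 : coeff c z ≠ 0 := Finsupp.mem_support_iff.mp hc
  -- With descents at all of `S` the greedy word would be standard NBC⁺, and the coefficient at `c`
  -- would vanish.
  obtain ⟨p, q, hpq, hq, hle⟩ : ∃ p q : Fin (rank (⊤ : P)),
      (p : ℕ) + 1 = q ∧ (q : ℕ) ∈ S ∧ (G c).1 p ≤ (G c).1 q := by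
    by_contra! hcon
    exact hc0 (h ⟨G c, (hG c).isStandard hcon, (hG c).isNBCPlus⟩ c (hG c).refines)
  obtain ⟨i, hi⟩ := exists_rank_chain_eq hk c hq
  obtain _ | k := k
  · exact i.elim0
  have hgreedy := (hG c).erase hi.symm hpq hle
  have h0 := congrArg (coeff (c.erase i)) (mem_cycles_succ.mp hz)
  -- The greedy word of `c'` refines the common face, for which that of `c` is least; by maximality
  -- the words agree, and a word determines its chain.
  have hself : ∀ c' ∈ (z : StrictChain (RankSelected P S) (k + 1) →₀ ℂ).support,
      ∀ i', c'.erase i' = c.erase i → c' = c ∧ i' = i := by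
    intro c' hc' i' he
    have hii := eq_of_erase_eq_erase hk he
    have hle' := hgreedy.toLex_le (he ▸ (hG c').refines.erase i')
    have hGG : G c' = G c := Subtype.ext (toLex.injective (le_antisymm (hmax c' hc') hle'))
    refine ⟨Subtype.ext (funext fun j => Subtype.ext ?_), hii⟩
    rw [← (hG c').refines j, ← (hG c).refines j, hGG, rank_chain_eq hk, rank_chain_eq hk]
  rw [coeff_boundary, map_zero, Finset.sum_eq_single c, Finset.sum_eq_single i] at h0
  · rw [coeff_toChains, if_pos rfl, mul_one] at h0
    exact mul_ne_zero hc0 (pow_ne_zero _ (by norm_num)) h0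
  · intro i' _ hne'
    rw [coeff_toChains, if_neg fun he => hne' (hself c hc i' he).2, mul_zero]
  · exact fun h' => absurd (mem_univ i) h'
  · intro c' hc' hne'
    refine mul_eq_zero_of_right _ (Finset.sum_eq_zero fun i' _ => ?_)
    rw [coeff_toChains, if_neg fun he => hne' (hself c' hc' i' he).1, mul_zero]
  · exact fun h' => absurd hc h'

instance : Finite (StandardNBCFilling P S) :=
  inferInstanceAs (Finite {F : BasisFilling P // F.IsStandard S ∧ F.IsNBCPlus})

/-- The coefficients of a cycle at the chains of the standard NBC⁺ fillings. -/
noncomputable def standardCoeff (hS : S ⊆ Finset.Ioo 0 (rank (⊤ : P))) :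
    cycles (RankSelected P S) S.card →ₗ[ℂ] StandardNBCFilling P S → ℂ :=
  LinearMap.pi fun T => coeff (T.1.selectedChain hS) ∘ₗ Submodule.subtype _

theorem standardCoeff_injective (hS : S ⊆ Finset.Ioo 0 (rank (⊤ : P))) :
    Function.Injective (standardCoeff hS) := by
  rw [injective_iff_map_eq_zero]
  intro z hz
  refine Subtype.ext (eq_zero_of_mem_cycles rfl z.2 fun T c hc => ?_)
  rw [refines_iff_selectedChain_eq hS] at hc
  rw [← hc]
  exact congrFun hz T

end Spanning

end RibbonHomology

/-- Independence bounds the number of fillings by the dimension of the cycle space, and injectivity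
of `standardCoeff` gives the reverse bound. An independent family of that size is a basis, which
passes to the quotient by zero boundaries. -/
theorem mainTheorem2 (P : Type*) [Lattice P] [BoundedOrder P] [Finite P]
    [IsAtomistic P] [IsWeakUpperModularLattice P] [LinearOrder (Atom P)]
    (S : Finset ℕ) (hS : S ⊆ Finset.Ioo 0 (rank (⊤ : P))) :
    ∃ hcycle : ∀ T : StandardNBCFilling P S,
        fbarChain hS (polytabloid S T.1) ∈ cycles (RankSelected P S) S.card,
      ∃ b : Module.Basis (StandardNBCFilling P S) ℂ (Beta P S),
        ∀ T : StandardNBCFilling P S,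
          b T = Submodule.Quotient.mk ⟨fbarChain hS (polytabloid S T.1), hcycle T⟩ := by
  have hcycle : ∀ T : StandardNBCFilling P S,
      fbarChain hS (polytabloid S T.1) ∈ cycles (RankSelected P S) S.card :=
    fun T => fbarChain_polytabloid_mem_cycles hS T.1
  refine ⟨hcycle, ?_⟩
  have := Fintype.ofFinite (StandardNBCFilling P S)
  have hfin : Module.Finite ℂ (cycles (RankSelected P S) S.card) :=
    Module.Finite.of_injective (standardCoeff hS) (standardCoeff_injective hS)
  have hind : LinearIndependent ℂ fun T : StandardNBCFilling P S =>
      (⟨fbarChain hS (polytabloid S T.1), hcycle T⟩ : cycles (RankSelected P S) S.card) :=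
    LinearIndependent.of_comp (Submodule.subtype _) (linearIndependent_fbarChain_polytabloid hS)
  have hcard : Fintype.card (StandardNBCFilling P S) =
      Module.finrank ℂ (cycles (RankSelected P S) S.card) := by
    refine le_antisymm hind.fintype_card_le_finrank ?_
    have h := LinearMap.finrank_le_finrank_of_injective (standardCoeff_injective hS)
    rwa [Module.finrank_fintype_fun_eq_card] at h
  have hbot : (boundaries (RankSelected P S) S.card).submoduleOf
      (cycles (RankSelected P S) S.card) = ⊥ := by
    rw [boundaries_card_eq_bot, Submodule.submoduleOf, Submodule.comap_bot, Submodule.ker_subtype]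
  refine ⟨(basisOfLinearIndependentOfCardEqFinrank' _ hind hcard).map
    (Submodule.quotEquivOfEqBot _ hbot).symm, fun T => ?_⟩
  simp
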